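/- Let $D>0$ and let $(\mathcal X,\|\cdot\|)$ be a separable real Banach space that is $(2,D)$-smooth, i.e. $\|x+y\|^2+\|x-y\|^2\le 2\|x\|^2+2D^2\|y\|^2$ for all $x,y\in\mathcal X$. Let $(\Omega,F,\mathbf P)$ be a probability space with a non-decreasing sequence $(F_j)_{j\ge 0}$ of sub-$\sigma$-fields of $F$, and let $f=(f_j)_{j\ge 0}$ be an $\mathcal X$-valued martingale relative to $(F_j)$ (with Bochner-integrable $f_j$) such that $f_0\equiv 0$. Put $d_0\equiv 0$, $d_j=f_j-f_{j-1}$ for $j\ge 1$, $f^*=\sup_{j\ge 0}\|f_j\|$, $d^*=\sup_{j\ge 0}\|d_j\|$, and $s_2=\Bigl(\sum_{j=1}^\infty \mathbf E\bigl(\|d_j\|^2\mid F_{j-1}\bigr)\Bigr)^{1/2}$ (these may a priori be infinite). Suppose that $\|d^*\|_\infty\le a$ and $\|s_2\|_\infty\le b/D$ for some $a>0$, $b>0$, where $\|\cdot\|_\infty$ is the essential supremum norm. Then for all $r\ge 0$, $$\mathbf P(f^*\ge r)\le 2\exp\left[\frac ra-\left(\frac ra+\frac{b^2}{a^2}\right)\ln\left(1+\frac{ra}{b^2}\right)\right]\le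 2\left(\frac{eb^2}{ra}\right)^{r/a},$$ where for $r=0$ the rightmost expression is understood as its limit, $2$. -/

import Mathlib

open MeasureTheory
open scoped ENNReal

/-- A real normed space `E` is `(2, D)`-smooth, where `D > 0`, if
`‖x + y‖² + ‖x - y‖² ≤ 2 ‖x‖² + 2 D² ‖y‖²` for all `x, y`. -/
def IsTwoSmooth (E : Type*) [NormedAddCommGroup E] (D : ℝ) : Prop :=
  0 < D ∧ ∀ x y : E, ‖x + y‖ ^ 2 + ‖x - y‖ ^ 2 ≤ 2 * ‖x‖ ^ 2 + 2 * D ^ 2 * ‖y‖ ^ 2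

/-- The increments of a sequence: `d₀ = 0` and `d_j = f_j - f_{j-1}` for `j ≥ 1`. -/
def increment {Ω E : Type*} [NormedAddCommGroup E] (f : ℕ → Ω → E) : ℕ → Ω → E
  | 0 => 0
  | j + 1 => f (j + 1) - f j

/-- The maximal function `h* = sup {‖h_j‖ : j = 0, 1, …}`, with values in `[0, ∞]`. -/
noncomputable def maximal {Ω E : Type*} [NormedAddCommGroup E] (h : ℕ → Ω → E) (ω : Ω) : ℝ≥0∞ :=
  ⨆ j : ℕ, ‖h j ω‖ₑ

/-- The conditional square function `s₂ = (∑_{j ≥ 1} E[‖d_j‖² | F_{j-1}])^{1/2}`, with values in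
`[0, ∞]`; `condLExp` is the conditional expectation of `[0, ∞]`-valued functions, so no second
moment is presupposed. The sum below is over `i = j - 1 ≥ 0`. -/
noncomputable def condSquare {Ω E : Type*} [NormedAddCommGroup E] {m : MeasurableSpace Ω}
    (μ : Measure Ω) (ℱ : Filtration ℕ m) (f : ℕ → Ω → E) (ω : Ω) : ℝ≥0∞ :=
  (∑' i : ℕ, condLExp (ℱ i) μ (fun ω' => ‖increment f (i + 1) ω'‖ₑ ^ 2) ω) ^ (1 / 2 : ℝ)

/-! For `l ≥ 0` put `κ = (exp (l a) - 1 - l a) / a ^ 2`. The process `exp (-κ D² ∑_{i<n}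
E[‖d_{i+1}‖² | F_i]) cosh (l ‖f_n‖)` is a nonnegative supermartingale started at `1`. Since `D² s₂²
≤ b²`, Ville's inequality and `cosh x ≥ exp x / 2` give the tail bound `2 exp (κ b² - l r)`, which
is then minimised over `l`.

The supermartingale property rests on `IsTwoSmooth.cosh_norm_add_le`: `cosh ‖x + y‖` is at most
`cosh ‖x‖` plus a term linear in `y` plus `D² cosh ‖x‖ (exp ‖y‖ - 1 - ‖y‖)`. No second derivative of
the norm is needed: smoothness yields a gradient of `‖·‖²` with remainder `D² ‖y‖²`, and this passes
to `cosh √u = ∑ u ^ k / (2k)!` term by term. -/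

/-- `p` is a field of gradients of `x ↦ ‖x‖ ^ 2` with a quadratic remainder of constant `D ^ 2`. -/
structure IsSqNormGradient {E : Type*} [NormedAddCommGroup E] [NormedSpace ℝ E] (D : ℝ)
    (p : E → E →L[ℝ] ℝ) : Prop where
  le_sq_norm_add : ∀ x y, ‖x‖ ^ 2 + p x y ≤ ‖x + y‖ ^ 2
  sq_norm_add_le : ∀ x y, ‖x + y‖ ^ 2 ≤ ‖x‖ ^ 2 + p x y + D ^ 2 * ‖y‖ ^ 2
  norm_le : ∀ x, ‖p x‖ ≤ 2 * ‖x‖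

/-! ### Gradient of the squared norm -/

section Gradient

variable {E : Type*} [NormedAddCommGroup E] [NormedSpace ℝ E] {D : ℝ}

/-- A function with `R y ≤ 2 R (y / 2) + D² ‖y‖² / 2` and of quadratic growth is at most
`D² ‖y‖²`. -/
theorem le_sq_norm_of_le_two_mul_half {R : E → ℝ}
    (h₀ : ∀ y, R y ≤ 2 * D ^ 2 * ‖y‖ ^ 2)
    (h : ∀ y, R y ≤ 2 * R ((1 / 2 : ℝ) • y) + D ^ 2 * ‖y‖ ^ 2 / 2) (y : E) :
    R y ≤ D ^ 2 * ‖y‖ ^ 2 := by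
  -- Each use of `h` halves the excess of the constant over `1`.
  have key : ∀ (n : ℕ) (y : E), R y ≤ (1 + (1 / 2) ^ n) * (D ^ 2 * ‖y‖ ^ 2) := by
    intro n
    induction n with
    | zero => intro y; linarith [h₀ y]
    | succ n ih =>
      intro y
      have h1 := ih ((1 / 2 : ℝ) • y)
      have h2 := h y
      rw [norm_smul, Real.norm_of_nonneg (by norm_num)] at h1
      rw [pow_succ]
      linarith
  have hlim : Filter.Tendsto (fun n : ℕ ↦ (1 + (1 / 2 : ℝ) ^ n) * (D ^ 2 * ‖y‖ ^ 2))
      Filter.atTop (nhds ((1 + 0) * (D ^ 2 * ‖y‖ ^ 2))) :=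
    ((tendsto_pow_atTop_nhds_zero_of_lt_one (by norm_num) (by norm_num)).const_add 1).mul_const _
  simpa using ge_of_tendsto' hlim fun n ↦ key n y

/-- If `j x` norms `x`, then `2 ‖x‖ j x` is a subgradient of `‖·‖²`. Smoothness at `(x, y)` with the
subgradient bound at `-y` gives a crude remainder `2 D² ‖y‖²`; smoothness at `(x + y/2, y/2)` gives
the halving inequality that sharpens it. -/
theorem IsTwoSmooth.exists_isSqNormGradient (hE : IsTwoSmooth E D) :
    ∃ p : E → E →L[ℝ] ℝ, IsSqNormGradient D p := by
  choose j hj hjx using fun x : E ↦ exists_dual_vector'' ℝ x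
  have hlow : ∀ x y, ‖x‖ ^ 2 + ((2 * ‖x‖) • j x) y ≤ ‖x + y‖ ^ 2 := by
    intro x y
    have h1 : |j x (x + y)| ≤ ‖x + y‖ := by
      simpa using (j x).le_of_opNorm_le (hj x) (x + y)
    have h2 : j x (x + y) = ‖x‖ + j x y := by rw [map_add, hjx]; rfl
    have h3 := sq_le_sq' (abs_le.1 h1).1 (abs_le.1 h1).2
    rw [h2] at h3
    simp only [smul_apply, smul_eq_mul]
    nlinarith [sq_nonneg (j x y)]
  refine ⟨fun x ↦ (2 * ‖x‖) • j x, hlow, fun x y ↦ ?_, fun x ↦ ?_⟩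
  · have := le_sq_norm_of_le_two_mul_half (D := D)
      (R := fun y ↦ ‖x + y‖ ^ 2 - ‖x‖ ^ 2 - ((2 * ‖x‖) • j x) y) ?_ ?_ y
    · linarith
    · intro y
      have h1 := hE.2 x y
      have h2 := hlow x (-y)
      rw [map_neg, ← sub_eq_add_neg, ← sub_eq_add_neg] at h2
      linarith
    · intro y
      have h1 := hE.2 (x + (1 / 2 : ℝ) • y) ((1 / 2 : ℝ) • y)
      rw [add_sub_cancel_right, add_assoc, ← add_smul, norm_smul, Real.norm_of_nonneg (by norm_num)]
        at h1
      norm_num at h1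
      simp only [map_smul, smul_eq_mul]
      norm_num
      linarith
  · rw [norm_smul, Real.norm_of_nonneg (by positivity)]
    exact mul_le_of_le_one_right (by positivity) (hj x)

/-- Comparing the expansions at `x` and `x'` on vectors of length `‖x' - x‖` gives the Lipschitz
constant `4 D²`. Continuity makes the linear term measurable later. -/
theorem IsSqNormGradient.continuous {p : E → E →L[ℝ] ℝ} (hp : IsSqNormGradient D p) :
    Continuous p := by
  have key : ∀ x x' y : E, p x' y - p x y ≤ D ^ 2 * (‖x' - x‖ + ‖y‖) ^ 2 := by
    intro x x' y
    have h1 := hp.le_sq_norm_add x' y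
    have h2 := hp.sq_norm_add_le x (x' - x + y)
    have h3 := hp.le_sq_norm_add x (x' - x)
    rw [add_sub_cancel] at h3
    rw [← add_assoc, add_sub_cancel, map_add] at h2
    have h4 : ‖x' - x + y‖ ^ 2 ≤ (‖x' - x‖ + ‖y‖) ^ 2 := by gcongr; exact norm_add_le _ _
    nlinarith [sq_nonneg D]
  have hlip : ∀ x x', ‖p x' - p x‖ ≤ 4 * D ^ 2 * ‖x' - x‖ := by
    intro x x'
    rcases eq_or_ne x' x with rfl | hx
    · simp
    have hpos : 0 < ‖x' - x‖ := norm_pos_iff.2 (sub_ne_zero.2 hx)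
    refine ContinuousLinearMap.opNorm_le_of_unit_norm (by positivity) fun z hz ↦ ?_
    have hn : ∀ w : E, ‖w‖ = 1 → (p x' - p x) w ≤ 4 * D ^ 2 * ‖x' - x‖ := by
      intro w hw
      have h := key x x' (‖x' - x‖ • w)
      rw [norm_smul, norm_norm, hw, map_smul, map_smul, smul_eq_mul, smul_eq_mul] at h
      rw [sub_apply]
      refine le_of_mul_le_mul_left ?_ hpos
      nlinarith
    rw [Real.norm_eq_abs, abs_le]
    refine ⟨?_, hn z hz⟩
    have := hn (-z) (by rwa [norm_neg])
    rw [map_neg] at this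
    linarith
  refine (LipschitzWith.of_dist_le_mul (K := ⟨4 * D ^ 2, by positivity⟩) fun x' x ↦ ?_).continuous
  rw [dist_eq_norm, dist_eq_norm]
  exact hlip x x'

end Gradient

/-! ### Second-order bound for the hyperbolic cosine of the norm -/

/-- `sinh t / (2 t)`, continued by `1 / 2` at `t = 0`: the derivative of `u ↦ cosh √u` at
`u = t ^ 2`. -/
noncomputable def halfSinhc (t : ℝ) : ℝ := if t = 0 then 1 / 2 else Real.sinh t / (2 * t)

theorem measurable_halfSinhc : Measurable halfSinhc :=
  Measurable.ite (measurableSet_singleton 0) measurable_const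
    (Real.measurable_sinh.div (measurable_const.mul measurable_id))

theorem two_mul_halfSinhc (t : ℝ) : 2 * t * halfSinhc t = Real.sinh t := by
  unfold halfSinhc
  split_ifs with h
  · simp [h]
  · field_simp

theorem halfSinhc_nonneg {t : ℝ} (ht : 0 ≤ t) : 0 ≤ halfSinhc t := by
  unfold halfSinhc
  split_ifs
  · norm_num
  · exact div_nonneg (Real.sinh_nonneg_iff.2 ht) (by positivity)

/-- Termwise derivative of `∑ u ^ k / (2k)!` at `u = t ^ 2`; the factor `k` kills the term where `k
- 1` truncates. -/
theorem hasSum_halfSinhc (t : ℝ) :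
    HasSum (fun k : ℕ ↦ k * (t ^ 2) ^ (k - 1) / (2 * k).factorial) (halfSinhc t) := by
  rw [← hasSum_nat_add_iff' 1]
  simp only [Finset.sum_range_one, Nat.cast_zero, zero_mul, zero_div, sub_zero,
    Nat.add_sub_cancel]
  have hterm : ∀ k : ℕ, ((k + 1 : ℕ) : ℝ) * (t ^ 2) ^ k / (2 * (k + 1)).factorial
      = t ^ (2 * k) / (2 * (2 * k + 1).factorial) := by
    intro k
    rw [show 2 * (k + 1) = (2 * k + 1) + 1 by ring, Nat.factorial_succ, ← pow_mul]
    push_cast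
    field_simp
    ring
  simp only [hterm]
  unfold halfSinhc
  split_ifs with h
  · subst h
    have hk : (fun k : ℕ ↦ (0 : ℝ) ^ (2 * k) / (2 * (2 * k + 1).factorial))
        = fun k ↦ if k = 0 then 1 / 2 else 0 := by
      funext k
      rcases k with _ | k <;> simp
    rw [hk]
    exact hasSum_ite_eq 0 _
  · have hk : (fun k : ℕ ↦ t ^ (2 * k) / (2 * (2 * k + 1).factorial))
        = fun k ↦ t ^ (2 * k + 1) / (2 * k + 1).factorial / (2 * t) := by
      funext k
      rw [pow_succ]
      field_simp
    rw [hk]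
    exact (Real.hasSum_sinh t).div_const _

/-- The remainder of the first-order expansion of `u ↦ u ^ k` at `v ≥ 0` is largest at the right
end of a symmetric interval. -/
theorem pow_remainder_le {v w q : ℝ} (hv : 0 ≤ v) (hvw : 0 ≤ v + w) (hw : |w| ≤ q) (k : ℕ) :
    0 ≤ (v + w) ^ k - v ^ k - k * v ^ (k - 1) * w ∧
      (v + w) ^ k - v ^ k - k * v ^ (k - 1) * w
        ≤ (v + q) ^ k - v ^ k - k * v ^ (k - 1) * q := by
  have hwq : w ≤ q := (le_abs_self w).trans hw
  have hsq : w ^ 2 ≤ q ^ 2 := sq_le_sq' (by linarith [neg_abs_le w]) hwq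
  have step : ∀ (k : ℕ) (w : ℝ), (v + w) ^ (k + 1) - v ^ (k + 1) - (k + 1 : ℕ) * v ^ k * w
      = (v + w) * ((v + w) ^ k - v ^ k - k * v ^ (k - 1) * w) + k * v ^ (k - 1) * w ^ 2 := by
    intro k w
    rcases k with _ | k
    · simp
    · simp only [Nat.add_sub_cancel]; push_cast; ring
  induction k with
  | zero => simp
  | succ k ih =>
    rw [Nat.add_sub_cancel, step, step]
    refine ⟨by have := ih.1; positivity, ?_⟩
    have := ih.1.trans ih.2
    exact add_le_add (mul_le_mul (by linarith) ih.2 ih.1 (by linarith [(abs_nonneg w).trans hw]))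
      (mul_le_mul_of_nonneg_left hsq (by positivity))

/-- The second-order bound for `cosh ‖·‖` along a gradient of the squared norm, before the
remainder is simplified. -/
theorem cosh_le_of_sq_le {τ η u P D : ℝ} (hτ : 0 ≤ τ) (hD : 1 ≤ D ^ 2)
    (hu : |u| ≤ τ + η) (hu' : τ ≤ |u| + η) (hP : u ^ 2 ≤ τ ^ 2 + P + D ^ 2 * η ^ 2) :
    Real.cosh u ≤ Real.cosh τ + halfSinhc τ * P
      + D ^ 2 * (Real.cosh (τ + η) - Real.cosh τ - Real.sinh τ * η) := by
  have hw : |u ^ 2 - τ ^ 2| ≤ 2 * τ * η + η ^ 2 := by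
    rw [← sq_abs u, abs_le]
    constructor <;> nlinarith [abs_nonneg u]
  have hterm : ∀ k : ℕ, u ^ (2 * k) / (2 * k).factorial ≤ τ ^ (2 * k) / (2 * k).factorial
      + k * (τ ^ 2) ^ (k - 1) / (2 * k).factorial * P
      + D ^ 2 * ((τ + η) ^ (2 * k) / (2 * k).factorial - τ ^ (2 * k) / (2 * k).factorial
        - k * (τ ^ 2) ^ (k - 1) / (2 * k).factorial * (2 * τ * η)) := by
    intro k
    obtain ⟨h1, h2⟩ := pow_remainder_le (sq_nonneg τ) (by nlinarith [sq_nonneg u]) hw k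
    have h0 := h1.trans h2
    rw [add_sub_cancel] at h1 h2
    rw [show τ ^ 2 + (2 * τ * η + η ^ 2) = (τ + η) ^ 2 by ring] at h0 h2
    have hk : 0 ≤ (k : ℝ) * (τ ^ 2) ^ (k - 1) := by positivity
    have h3 : (k : ℝ) * (τ ^ 2) ^ (k - 1) * (u ^ 2 - τ ^ 2)
        ≤ k * (τ ^ 2) ^ (k - 1) * (P + D ^ 2 * η ^ 2) := by gcongr; linarith
    -- `D² ≥ 1` puts the same factor on both remainders; the two `D² η²` contributions then cancel,
    -- leaving `2 τ η`.
    have h4 := mul_le_mul_of_nonneg_right hD h0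
    have h5 : (u ^ 2) ^ k ≤ (τ ^ 2) ^ k + k * (τ ^ 2) ^ (k - 1) * P
        + D ^ 2 * (((τ + η) ^ 2) ^ k - (τ ^ 2) ^ k - k * (τ ^ 2) ^ (k - 1) * (2 * τ * η)) := by
      linarith
    have h6 := div_le_div_of_nonneg_right h5 (Nat.cast_nonneg (2 * k).factorial)
    simp only [pow_mul]
    refine h6.trans (le_of_eq ?_)
    ring
  have hsum := hasSum_le hterm (Real.hasSum_cosh u)
    (((Real.hasSum_cosh τ).add ((hasSum_halfSinhc τ).mul_right P)).add
      ((((Real.hasSum_cosh (τ + η)).sub (Real.hasSum_cosh τ)).sub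
        ((hasSum_halfSinhc τ).mul_right (2 * τ * η))).mul_left (D ^ 2)))
  rw [← two_mul_halfSinhc τ]
  linarith

theorem cosh_add_sub_le {τ η : ℝ} (hη : 0 ≤ η) :
    Real.cosh (τ + η) - Real.cosh τ - Real.sinh τ * η
      ≤ Real.cosh τ * (Real.exp η - 1 - η) := by
  have h1 : η ≤ Real.sinh η := Real.self_le_sinh_iff.2 hη
  have h2 : Real.sinh τ ≤ Real.cosh τ := (Real.sinh_lt_cosh τ).le
  rw [Real.cosh_add, ← Real.cosh_add_sinh η]
  nlinarith

theorem IsTwoSmooth.one_le_sq {E : Type*} [NormedAddCommGroup E] {D : ℝ} (hE : IsTwoSmooth E D)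
    {y : E} (hy : y ≠ 0) : 1 ≤ D ^ 2 := by
  have h := hE.2 0 y
  have hy' : 0 < ‖y‖ ^ 2 := by positivity
  simp only [zero_add, zero_sub, norm_neg, norm_zero] at h
  nlinarith

theorem IsTwoSmooth.cosh_norm_add_le {E : Type*} [NormedAddCommGroup E] [NormedSpace ℝ E] {D : ℝ}
    (hE : IsTwoSmooth E D) {p : E → E →L[ℝ] ℝ} (hp : IsSqNormGradient D p) (x y : E) :
    Real.cosh ‖x + y‖ ≤ Real.cosh ‖x‖ + halfSinhc ‖x‖ * p x y
      + D ^ 2 * (Real.cosh ‖x‖ * (Real.exp ‖y‖ - 1 - ‖y‖)) := by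
  rcases eq_or_ne y 0 with rfl | hy
  · simp
  refine (cosh_le_of_sq_le (norm_nonneg x) (hE.one_le_sq hy) ?_ ?_
    (hp.sq_norm_add_le x y)).trans ?_
  · rw [abs_norm]; exact norm_add_le x y
  · rw [abs_norm]; simpa using norm_sub_le (x + y) y
  · gcongr
    exact cosh_add_sub_le (norm_nonneg y)

/-- `(exp x - 1 - x) / x ^ 2` has nonnegative Taylor coefficients, so it increases on `x ≥ 0`. -/
theorem exp_sub_one_sub_le {l a η : ℝ} (hl : 0 ≤ l) (ha : 0 < a) (hη : 0 ≤ η) (hηa : η ≤ a) :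
    Real.exp (l * η) - 1 - l * η ≤ (Real.exp (l * a) - 1 - l * a) / a ^ 2 * η ^ 2 := by
  have hs : ∀ x : ℝ, HasSum (fun k : ℕ ↦ x ^ (k + 2) / (k + 2).factorial)
      (Real.exp x - 1 - x) := by
    intro x
    have h := (hasSum_nat_add_iff' 2).2 (NormedSpace.expSeries_div_hasSum_exp (𝔸 := ℝ) x)
    rw [← Real.exp_eq_exp_ℝ] at h
    simpa [Finset.sum_range_succ, sub_sub] using h
  refine hasSum_le (fun k ↦ ?_) (hs (l * η)) (((hs (l * a)).div_const (a ^ 2)).mul_right (η ^ 2))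
  have : (l * a) ^ (k + 2) / (k + 2).factorial / a ^ 2 * η ^ 2
      = l ^ (k + 2) * (a ^ k * η ^ 2) / (k + 2).factorial := by
    field_simp
    ring
  rw [this, mul_pow, pow_add η]
  gcongr

/-! ### Maximal inequality for nonnegative supermartingales -/

section MaximalInequality

variable {Ω : Type*} {m : MeasurableSpace Ω} {μ : Measure Ω} [IsFiniteMeasure μ]
  {ℱ : Filtration ℕ m} {G : ℕ → Ω → ℝ}

/-- In place of a stopping time: `c` times the probability of having reached `c` by time `n`, plus
the integral of `G n` over the complement, does not increase with `n`. -/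
theorem MeasureTheory.Supermartingale.mul_measureReal_exists_le_le
    (hG : Supermartingale G ℱ μ) (h0 : ∀ n ω, 0 ≤ G n ω) {c : ℝ} (n : ℕ) :
    c * μ.real {ω | ∃ j ≤ n, c ≤ G j ω} ≤ ∫ ω, G 0 ω ∂μ := by
  have hmeas : ∀ n, MeasurableSet[ℱ n] {ω | ∃ j ≤ n, c ≤ G j ω} := by
    intro n
    have : {ω | ∃ j ≤ n, c ≤ G j ω} = ⋃ j ∈ Set.Iic n, {ω | c ≤ G j ω} := by ext; simp
    rw [this]
    refine MeasurableSet.biUnion (Set.to_countable _) fun j hj ↦ ?_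
    exact measurableSet_le measurable_const ((hG.stronglyAdapted j).mono (ℱ.mono hj)).measurable
  have hstep : ∀ n (s t : Set Ω), MeasurableSet s → MeasurableSet t → s ⊆ t →
      (∀ ω ∈ t \ s, c ≤ G n ω) →
      c * μ.real sᶜ + ∫ ω in s, G n ω ∂μ ≤ c * μ.real tᶜ + ∫ ω in t, G n ω ∂μ := by
    intro n s t hs ht hst hc
    have h1 : ∫ ω in t, G n ω ∂μ = ∫ ω in s, G n ω ∂μ + ∫ ω in t \ s, G n ω ∂μ := by
      rw [← setIntegral_union Set.disjoint_sdiff_right (ht.diff hs)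
        (hG.integrable n).integrableOn (hG.integrable n).integrableOn, Set.union_sdiff_cancel hst]
    have h2 : μ.real sᶜ = μ.real tᶜ + μ.real (t \ s) := by
      have hdisj : Disjoint tᶜ (t \ s) := disjoint_compl_left.mono_right Set.sdiff_subset
      rw [← measureReal_union hdisj (ht.diff hs)]
      congr 1
      ext ω
      have := @hst ω
      simp only [Set.mem_compl_iff, Set.mem_union, Set.mem_sdiff]
      tauto
    have h3 : c * μ.real (t \ s) ≤ ∫ ω in t \ s, G n ω ∂μ :=
      setIntegral_ge_of_const_le_real (ht.diff hs) (measure_ne_top _ _) hc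
        (hG.integrable n).integrableOn
    rw [h1, h2]
    linarith
  have key : ∀ n, c * μ.real {ω | ∃ j ≤ n, c ≤ G j ω}
      + ∫ ω in {ω | ∃ j ≤ n, c ≤ G j ω}ᶜ, G n ω ∂μ ≤ ∫ ω, G 0 ω ∂μ := by
    intro n
    induction n with
    | zero =>
      have := hstep 0 {ω | ∃ j ≤ 0, c ≤ G j ω}ᶜ Set.univ ((ℱ.le 0 _ (hmeas 0)).compl) .univ
        (Set.subset_univ _) (by simp)
      simpa using this
    | succ n ih =>
      have h1 := hstep (n + 1) {ω | ∃ j ≤ n + 1, c ≤ G j ω}ᶜ {ω | ∃ j ≤ n, c ≤ G j ω}ᶜ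
        ((ℱ.le _ _ (hmeas _)).compl) ((ℱ.le _ _ (hmeas _)).compl) ?_ ?_
      · rw [compl_compl, compl_compl] at h1
        have h2 := hG.setIntegral_le (Nat.le_succ n) (hmeas n).compl
        simp only [Nat.succ_eq_add_one] at h2
        linarith
      · rw [Set.compl_subset_compl]
        rintro ω ⟨j, hj, h⟩
        exact ⟨j, hj.trans n.le_succ, h⟩
      · rintro ω ⟨h, h'⟩
        rw [Set.mem_compl_iff, not_not] at h'
        obtain ⟨j, hj, hc⟩ := h'
        rcases Nat.le_succ_iff.1 hj with hj | rfl
        · exact absurd ⟨j, hj, hc⟩ h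
        · exact hc
  have hpos : 0 ≤ ∫ ω in {ω | ∃ j ≤ n, c ≤ G j ω}ᶜ, G n ω ∂μ := integral_nonneg (h0 n)
  linarith [key n]

/-- Ville's inequality. -/
theorem MeasureTheory.Supermartingale.mul_measureReal_exists_le
    (hG : Supermartingale G ℱ μ) (h0 : ∀ n ω, 0 ≤ G n ω) {c : ℝ} :
    c * μ.real {ω | ∃ j, c ≤ G j ω} ≤ ∫ ω, G 0 ω ∂μ := by
  have hU : {ω | ∃ j, c ≤ G j ω} = ⋃ n, {ω | ∃ j ≤ n, c ≤ G j ω} := by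
    ext ω
    simp only [Set.mem_ofPred_eq, Set.mem_iUnion]
    exact ⟨fun ⟨j, h⟩ ↦ ⟨j, j, le_rfl, h⟩, fun ⟨_, j, _, h⟩ ↦ ⟨j, h⟩⟩
  have hmono : Monotone fun n ↦ {ω | ∃ j ≤ n, c ≤ G j ω} :=
    fun n k hnk ω ⟨j, hj, h⟩ ↦ ⟨j, hj.trans hnk, h⟩
  have hlim := (ENNReal.tendsto_toReal (measure_ne_top μ _)).comp
    (tendsto_measure_iUnion_atTop (μ := μ) hmono)
  rw [hU]
  exact le_of_tendsto' (hlim.const_mul c) fun n ↦ hG.mul_measureReal_exists_le_le h0 n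

end MaximalInequality

/-! ### One-step conditional estimate -/

section CondExp

variable {Ω E : Type*} {m' m : MeasurableSpace Ω} {μ : Measure Ω} [IsFiniteMeasure μ]
  [NormedAddCommGroup E] [NormedSpace ℝ E] [CompleteSpace E] {D l a C : ℝ}

/-- The conditional exponential-moment bound for one step of a martingale with bounded
increments. -/
theorem IsTwoSmooth.condExp_mul_cosh_norm_add_le (hE : IsTwoSmooth E D) (hm : m' ≤ m)
    (hl : 0 ≤ l) (ha : 0 < a) {X Y : Ω → E} {w : Ω → ℝ}
    (hX : StronglyMeasurable[m'] X) (hY : Integrable Y μ) (hY0 : μ[Y | m'] =ᵐ[μ] 0)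
    (hw : StronglyMeasurable[m'] w) (hw0 : ∀ ω, 0 ≤ w ω) (hw1 : ∀ᵐ ω ∂μ, w ω ≤ 1)
    (hXC : ∀ᵐ ω ∂μ, ‖X ω‖ ≤ C) (hYa : ∀ᵐ ω ∂μ, ‖Y ω‖ ≤ a) :
    μ[fun ω ↦ w ω * Real.cosh (l * ‖X ω + Y ω‖) | m'] ≤ᵐ[μ] fun ω ↦
      w ω * Real.cosh (l * ‖X ω‖)
        * (1 + (Real.exp (l * a) - 1 - l * a) / a ^ 2 * D ^ 2 * μ[fun ω ↦ ‖Y ω‖ ^ 2 | m'] ω) := by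
  obtain ⟨p, hp⟩ := hE.exists_isSqNormGradient
  set κ := (Real.exp (l * a) - 1 - l * a) / a ^ 2 * D ^ 2 with hκ
  set u : Ω → ℝ := fun ω ↦ w ω * Real.cosh (l * ‖X ω‖) with hu
  set v : Ω → ℝ := fun ω ↦ κ * u ω with hv
  -- Coefficient of the first-order term: being `m'`-measurable and bounded, it can be pulled out,
  -- and the term vanishes because `μ[Y | m'] = 0`.
  set q : Ω → E →L[ℝ] ℝ := fun ω ↦ (w ω * halfSinhc (l * ‖X ω‖) * l) • p (l • X ω) with hq
  have hlX : Measurable[m'] fun ω ↦ l * ‖X ω‖ := measurable_const.mul hX.norm.measurable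
  have hum : StronglyMeasurable[m'] u :=
    hw.mul (Real.measurable_cosh.comp hlX).stronglyMeasurable
  have hvm : StronglyMeasurable[m'] v := stronglyMeasurable_const.mul hum
  have hqm : StronglyMeasurable[m'] q :=
    ((hw.mul (measurable_halfSinhc.comp hlX).stronglyMeasurable).mul
      stronglyMeasurable_const).smul (hp.continuous.comp_stronglyMeasurable (hX.const_smul l))
  have hYm := hY.aestronglyMeasurable
  have hcosh : ∀ {s t : ℝ}, 0 ≤ s → s ≤ t → Real.cosh s ≤ Real.cosh t := fun hs hst ↦ by
    rw [Real.cosh_le_cosh, abs_of_nonneg hs, abs_of_nonneg (hs.trans hst)]; exact hst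
  have hub : ∀ᵐ ω ∂μ, ‖u ω‖ ≤ Real.cosh (l * C) := by
    filter_upwards [hw1, hXC] with ω h1 h2
    have h3 := hcosh (by positivity) (mul_le_mul_of_nonneg_left h2 hl)
    rw [Real.norm_of_nonneg (mul_nonneg (hw0 ω) (Real.cosh_pos _).le)]
    nlinarith [Real.cosh_pos (l * ‖X ω‖)]
  have hqb : ∀ᵐ ω ∂μ, ‖q ω‖ ≤ l * Real.sinh (l * C) := by
    filter_upwards [hw1, hXC] with ω h1 h2
    have h3 := Real.sinh_le_sinh.2 (mul_le_mul_of_nonneg_left h2 hl)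
    have h4 := halfSinhc_nonneg (show 0 ≤ l * ‖X ω‖ by positivity)
    have h5 : 0 ≤ Real.sinh (l * ‖X ω‖) := Real.sinh_nonneg_iff.2 (by positivity)
    have h6 := hp.norm_le (l • X ω)
    rw [norm_smul, Real.norm_of_nonneg hl] at h6
    have h7 : 0 ≤ w ω * halfSinhc (l * ‖X ω‖) * l := mul_nonneg (mul_nonneg (hw0 ω) h4) hl
    calc ‖q ω‖ = w ω * halfSinhc (l * ‖X ω‖) * l * ‖p (l • X ω)‖ := by
          rw [hq, norm_smul, Real.norm_of_nonneg h7]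
      _ ≤ w ω * halfSinhc (l * ‖X ω‖) * l * (2 * (l * ‖X ω‖)) := by gcongr
      _ = w ω * (l * Real.sinh (l * ‖X ω‖)) := by rw [← two_mul_halfSinhc]; ring
      _ ≤ 1 * (l * Real.sinh (l * C)) := by gcongr
      _ = _ := one_mul _
  have hY2i : Integrable (fun ω ↦ ‖Y ω‖ ^ 2) μ := by
    refine Integrable.of_bound (hYm.norm.pow 2) (a ^ 2) ?_
    filter_upwards [hYa] with ω h
    rw [Real.norm_of_nonneg (by positivity)]
    gcongr
  have hui : Integrable u μ := Integrable.of_bound (hum.mono hm).aestronglyMeasurable _ hub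
  have hvYi : Integrable (v * fun ω ↦ ‖Y ω‖ ^ 2) μ := by
    refine Integrable.bdd_mul (c := |κ| * Real.cosh (l * C)) hY2i
      (hvm.mono hm).aestronglyMeasurable ?_
    filter_upwards [hub] with ω h
    rw [hv, norm_mul, Real.norm_eq_abs]
    gcongr
  have hqYi : Integrable (fun ω ↦ ContinuousLinearMap.id ℝ (E →L[ℝ] ℝ) (q ω) (Y ω)) μ := by
    refine (hY.norm.const_mul (l * Real.sinh (l * C))).mono' ?_ ?_
    · exact (ContinuousLinearMap.id ℝ (E →L[ℝ] ℝ)).aestronglyMeasurable_comp₂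
        (hqm.mono hm).aestronglyMeasurable hYm
    · filter_upwards [hqb] with ω h
      exact (q ω).le_of_opNorm_le h (Y ω)
  have hbound : ∀ᵐ ω ∂μ, w ω * Real.cosh (l * ‖X ω + Y ω‖) ≤
      u ω + v ω * ‖Y ω‖ ^ 2 + ContinuousLinearMap.id ℝ (E →L[ℝ] ℝ) (q ω) (Y ω) := by
    filter_upwards [hYa] with ω h
    have h1 := hE.cosh_norm_add_le hp (l • X ω) (l • Y ω)
    rw [← smul_add, norm_smul, norm_smul, norm_smul, Real.norm_of_nonneg hl, map_smul,
      smul_eq_mul] at h1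
    have h2 := exp_sub_one_sub_le hl ha (norm_nonneg (Y ω)) h
    have h3 := mul_le_mul_of_nonneg_left h2 (Real.cosh_pos (l * ‖X ω‖)).le
    have h4 := mul_le_mul_of_nonneg_left h3 (sq_nonneg D)
    have h5 := mul_le_mul_of_nonneg_left (h1.trans (add_le_add_right h4 _)) (hw0 ω)
    refine h5.trans (le_of_eq ?_)
    simp only [hu, hv, hq, hκ, ContinuousLinearMap.id_apply, smul_apply, smul_eq_mul]
    ring
  have hLi : Integrable (fun ω ↦ w ω * Real.cosh (l * ‖X ω + Y ω‖)) μ := by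
    refine Integrable.of_bound (C := Real.cosh (l * (C + a))) ?_ ?_
    · refine (hw.mono hm).aestronglyMeasurable.mul
        (Real.continuous_cosh.comp_aestronglyMeasurable ?_)
      exact (((hX.mono hm).aestronglyMeasurable.add hYm).norm).const_mul l
    · filter_upwards [hw1, hXC, hYa] with ω h1 h2 h3
      have h4 : ‖X ω + Y ω‖ ≤ C + a := (norm_add_le _ _).trans (add_le_add h2 h3)
      have h5 := hcosh (by positivity) (mul_le_mul_of_nonneg_left h4 hl)
      rw [Real.norm_of_nonneg (mul_nonneg (hw0 ω) (Real.cosh_pos _).le)]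
      nlinarith [Real.cosh_pos (l * ‖X ω + Y ω‖)]
  have hmono := condExp_mono (m := m') hLi ((hui.add hvYi).add hqYi) hbound
  have hadd := condExp_add (hui.add hvYi) hqYi m'
  have hadd' := condExp_add hui hvYi m'
  have hpull := condExp_mul_of_stronglyMeasurable_left hvm hvYi hY2i
  have hpull' := condExp_bilin_of_stronglyMeasurable_left (m := m')
    (ContinuousLinearMap.id ℝ (E →L[ℝ] ℝ)) hqm hqYi hY
  have hself := condExp_of_stronglyMeasurable hm hum hui
  filter_upwards [hmono, hadd, hadd', hpull, hpull', hY0] with ω h1 h2 h3 h4 h5 h6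
  refine h1.trans (le_of_eq ?_)
  rw [h2, Pi.add_apply, h3, Pi.add_apply, h4, h5, h6, hself]
  simp only [Pi.mul_apply, Pi.zero_apply, map_zero, hv]
  ring

end CondExp

/-! ### Almost sure bounds from the hypotheses -/

section Bounds

variable {Ω E : Type*} {m : MeasurableSpace Ω} {μ : Measure Ω} [NormedAddCommGroup E]
  {f : ℕ → Ω → E} {a b : ℝ}

theorem ae_norm_increment_le (ha : 0 ≤ a)
    (hd : eLpNorm (maximal (increment f)) ∞ μ ≤ ENNReal.ofReal a) :
    ∀ᵐ ω ∂μ, ∀ j, ‖increment f j ω‖ ≤ a := by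
  rw [eLpNorm_exponent_top] at hd
  filter_upwards [ae_le_eLpNormEssSup (f := maximal (increment f)) (μ := μ)] with ω h j
  have h1 : ‖increment f j ω‖ₑ ≤ ENNReal.ofReal a :=
    ((le_iSup (fun j ↦ ‖increment f j ω‖ₑ) j).trans h).trans hd
  rwa [← ofReal_norm, ENNReal.ofReal_le_ofReal_iff ha] at h1

theorem ae_norm_le_mul (hf0 : f 0 = 0) (h : ∀ᵐ ω ∂μ, ∀ j, ‖increment f j ω‖ ≤ a) :
    ∀ᵐ ω ∂μ, ∀ n : ℕ, ‖f n ω‖ ≤ n * a := by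
  filter_upwards [h] with ω h n
  induction n with
  | zero => simp [hf0]
  | succ n ih =>
    have h1 := h (n + 1)
    have h2 : f (n + 1) ω = f n ω + increment f (n + 1) ω := by simp [increment]
    rw [h2]
    push_cast
    linarith [norm_add_le (f n ω) (increment f (n + 1) ω)]

theorem ae_sum_condExp_sq_increment_le {ℱ : Filtration ℕ m} [IsFiniteMeasure μ]
    (hb : 0 ≤ b) (hint : ∀ i, Integrable (fun ω ↦ ‖increment f (i + 1) ω‖ ^ 2) μ)
    (hs : eLpNorm (condSquare μ ℱ f) ∞ μ ≤ ENNReal.ofReal b) :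
    ∀ᵐ ω ∂μ, ∀ n, ∑ i ∈ Finset.range n, μ[fun ω ↦ ‖increment f (i + 1) ω‖ ^ 2 | ℱ i] ω
      ≤ b ^ 2 := by
  rw [eLpNorm_exponent_top] at hs
  have hcond : ∀ᵐ ω ∂μ, ∀ i, condLExp (ℱ i) μ (fun ω' ↦ ‖increment f (i + 1) ω'‖ₑ ^ 2) ω
      = ENNReal.ofReal (μ[fun ω ↦ ‖increment f (i + 1) ω‖ ^ 2 | ℱ i] ω) := by
    refine ae_all_iff.2 fun i ↦ ?_
    have h := condLExp_ofReal (ℱ i) (hint i) (Filter.Eventually.of_forall fun ω ↦ sq_nonneg _)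
    simp only [ENNReal.ofReal_pow (norm_nonneg _), ofReal_norm] at h
    exact h
  have hnn : ∀ᵐ ω ∂μ, ∀ i, 0 ≤ μ[fun ω ↦ ‖increment f (i + 1) ω‖ ^ 2 | ℱ i] ω :=
    ae_all_iff.2 fun i ↦ condExp_nonneg (Filter.Eventually.of_forall fun ω ↦ sq_nonneg _)
  filter_upwards [ae_le_eLpNormEssSup (f := condSquare μ ℱ f) (μ := μ), hcond, hnn] with ω h h1 h2 n
  have h3 : condSquare μ ℱ f ω ≤ ENNReal.ofReal b := h.trans hs
  have h4 := ENNReal.rpow_le_rpow h3 (show (0 : ℝ) ≤ 2 by norm_num)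
  rw [condSquare, ← ENNReal.rpow_mul] at h4
  norm_num at h4
  rw [← ENNReal.ofReal_pow hb] at h4
  have h5 := (ENNReal.sum_le_tsum (Finset.range n)).trans h4
  simp only [h1] at h5
  rwa [← ENNReal.ofReal_sum_of_nonneg fun i _ ↦ h2 i,
    ENNReal.ofReal_le_ofReal_iff (sq_nonneg b)] at h5

end Bounds

theorem MeasureTheory.Martingale.condExp_increment_succ {Ω E : Type*} {m : MeasurableSpace Ω}
    {μ : Measure Ω} [NormedAddCommGroup E] [NormedSpace ℝ E] [CompleteSpace E]
    {ℱ : Filtration ℕ m} {f : ℕ → Ω → E} (hf : Martingale f ℱ μ) (n : ℕ) :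
    μ[increment f (n + 1) | ℱ n] =ᵐ[μ] 0 := by
  have h := condExp_sub (hf.integrable (n + 1)) (hf.integrable n) (ℱ n)
  have h1 := hf.condExp_ae_eq n.le_succ
  have h2 := hf.condExp_ae_eq (le_refl n)
  filter_upwards [h, h1, h2] with ω h h1 h2
  rw [increment, h, Pi.sub_apply, h1, h2, sub_self, Pi.zero_apply]

/-! ### The supermartingale and its tail bound -/

section Martingale

variable {Ω E : Type*} {m : MeasurableSpace Ω} {μ : Measure Ω} [IsProbabilityMeasure μ]
  [NormedAddCommGroup E] [NormedSpace ℝ E] [CompleteSpace E] {D l a b : ℝ} {ℱ : Filtration ℕ m}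
  {f : ℕ → Ω → E}

/-- The compensated hyperbolic cosine of a martingale in a `(2, D)`-smooth space is a
supermartingale. -/
theorem IsTwoSmooth.supermartingale_cosh (hE : IsTwoSmooth E D) (hf : Martingale f ℱ μ)
    (hf0 : f 0 = 0) (hl : 0 ≤ l) (ha : 0 < a)
    (hd : ∀ᵐ ω ∂μ, ∀ j, ‖increment f j ω‖ ≤ a) :
    Supermartingale (fun n ω ↦ Real.exp (-((Real.exp (l * a) - 1 - l * a) / a ^ 2 * D ^ 2
      * ∑ i ∈ Finset.range n, μ[fun ω ↦ ‖increment f (i + 1) ω‖ ^ 2 | ℱ i] ω))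
        * Real.cosh (l * ‖f n ω‖)) ℱ μ := by
  set κ := (Real.exp (l * a) - 1 - l * a) / a ^ 2 * D ^ 2
  have hκ : 0 ≤ κ := by
    have := Real.add_one_le_exp (l * a)
    exact mul_nonneg (div_nonneg (by linarith) (by positivity)) (sq_nonneg D)
  set σ : ℕ → Ω → ℝ := fun i ↦ μ[fun ω ↦ ‖increment f (i + 1) ω‖ ^ 2 | ℱ i]
  have hσ : ∀ᵐ ω ∂μ, ∀ i, 0 ≤ σ i ω :=
    ae_all_iff.2 fun i ↦ condExp_nonneg (Filter.Eventually.of_forall fun ω ↦ sq_nonneg _)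
  set w : ℕ → Ω → ℝ := fun n ω ↦ Real.exp (-(κ * ∑ i ∈ Finset.range n, σ i ω)) with hw
  -- The compensator is predictable: `w (n + 1)` involves only `σ 0, …, σ n`, so it is already `ℱ
  -- n`-measurable.
  have hwm : ∀ n k, n ≤ k + 1 → StronglyMeasurable[ℱ k] (w n) := by
    intro n k hnk
    have : StronglyMeasurable[ℱ k] fun ω ↦ ∑ i ∈ Finset.range n, σ i ω :=
      Finset.stronglyMeasurable_fun_sum _ fun i hi ↦
        stronglyMeasurable_condExp.mono (ℱ.mono (by have := Finset.mem_range.1 hi; omega))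
    exact Real.continuous_exp.comp_stronglyMeasurable (this.const_mul κ).neg
  have hw1 : ∀ n, ∀ᵐ ω ∂μ, w n ω ≤ 1 := by
    intro n
    filter_upwards [hσ] with ω h
    rw [hw, Real.exp_le_one_iff, neg_nonpos]
    exact mul_nonneg hκ (Finset.sum_nonneg fun i _ ↦ h i)
  have hfb := ae_norm_le_mul hf0 hd
  have hadp : ∀ n, StronglyMeasurable[ℱ n] fun ω ↦ w n ω * Real.cosh (l * ‖f n ω‖) := fun n ↦
    (hwm n n n.le_succ).mul (Real.continuous_cosh.comp_stronglyMeasurable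
      ((hf.stronglyAdapted n).norm.const_mul l))
  refine supermartingale_nat hadp (fun n ↦ ?_) fun n ↦ ?_
  · refine Integrable.of_bound (C := Real.cosh (l * (n * a)))
      ((hadp n).mono (ℱ.le n)).aestronglyMeasurable ?_
    filter_upwards [hw1 n, hfb] with ω h1 h2
    have h3 : Real.cosh (l * ‖f n ω‖) ≤ Real.cosh (l * (n * a)) := by
      rw [Real.cosh_le_cosh, abs_of_nonneg (by positivity), abs_of_nonneg (by positivity)]
      exact mul_le_mul_of_nonneg_left (h2 n) hl
    rw [Real.norm_of_nonneg (mul_nonneg (Real.exp_pos _).le (Real.cosh_pos _).le)]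
    nlinarith [Real.cosh_pos (l * ‖f n ω‖)]
  · have h := hE.condExp_mul_cosh_norm_add_le (ℱ.le n) hl ha (hf.stronglyAdapted n)
      ((hf.integrable (n + 1)).sub (hf.integrable n)) (hf.condExp_increment_succ n)
      (hwm (n + 1) n le_rfl) (fun ω ↦ (Real.exp_pos _).le) (hw1 (n + 1))
      (hfb.mono fun ω h ↦ h n) (hd.mono fun ω h ↦ h (n + 1))
    simp only [Pi.sub_apply, add_sub_cancel] at h
    filter_upwards [h] with ω h
    refine h.trans ?_
    change w (n + 1) ω * Real.cosh (l * ‖f n ω‖) * (1 + κ * σ n ω) ≤ _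
    have h1 : w (n + 1) ω = w n ω * Real.exp (-(κ * σ n ω)) := by
      simp only [hw, Finset.sum_range_succ, ← Real.exp_add]
      ring_nf
    have h2 : Real.exp (-(κ * σ n ω)) * (1 + κ * σ n ω) ≤ 1 := by
      rw [Real.exp_neg, inv_mul_le_one₀ (Real.exp_pos _), add_comm]
      exact Real.add_one_le_exp _
    have h3 : 0 ≤ w n ω * Real.cosh (l * ‖f n ω‖) :=
      mul_nonneg (Real.exp_pos _).le (Real.cosh_pos _).le
    rw [h1]
    nlinarith

/-- The exponential tail bound with a free parameter `l`. -/
theorem IsTwoSmooth.measureReal_le_maximal_le (hE : IsTwoSmooth E D) (hf : Martingale f ℱ μ)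
    (hf0 : f 0 = 0) (hl : 0 ≤ l) (ha : 0 < a) (hb : 0 < b)
    (hd : eLpNorm (maximal (increment f)) ∞ μ ≤ ENNReal.ofReal a)
    (hs : eLpNorm (condSquare μ ℱ f) ∞ μ ≤ ENNReal.ofReal (b / D)) (r : ℝ) :
    μ.real {ω | ENNReal.ofReal r ≤ maximal f ω}
      ≤ 2 * Real.exp ((Real.exp (l * a) - 1 - l * a) / a ^ 2 * b ^ 2 - l * r) := by
  set κ := (Real.exp (l * a) - 1 - l * a) / a ^ 2 with hκ'
  have hκ : 0 ≤ κ := by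
    have := Real.add_one_le_exp (l * a)
    exact div_nonneg (by linarith) (by positivity)
  have hd' := ae_norm_increment_le ha.le hd
  have hG := hE.supermartingale_cosh hf hf0 hl ha hd'
  have hint : ∀ i, Integrable (fun ω ↦ ‖increment f (i + 1) ω‖ ^ 2) μ := fun i ↦ by
    refine Integrable.of_bound (C := a ^ 2)
      (((hf.integrable (i + 1)).sub (hf.integrable i)).aestronglyMeasurable.norm.pow 2) ?_
    filter_upwards [hd'] with ω h
    rw [Real.norm_of_nonneg (by positivity)]
    exact pow_le_pow_left₀ (norm_nonneg _) (h (i + 1)) 2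
  have hD := hE.1
  have hsum := ae_sum_condExp_sq_increment_le (div_nonneg hb.le hD.le) hint hs
  -- The supremum need not be attained, so a level `t < r` is used, and then `t → r`.
  have hlt : ∀ t, 0 ≤ t → t < r → μ.real {ω | ENNReal.ofReal r ≤ maximal f ω}
      ≤ 2 * Real.exp (κ * b ^ 2 - l * t) := by
    intro t ht htr
    have hville := hG.mul_measureReal_exists_le (c := Real.exp (-(κ * b ^ 2)) * Real.cosh (l * t))
      fun n ω ↦ mul_nonneg (Real.exp_pos _).le (Real.cosh_pos _).le
    simp only [Finset.range_zero, Finset.sum_empty, mul_zero, neg_zero, Real.exp_zero, hf0,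
      Pi.zero_apply, norm_zero, Real.cosh_zero, mul_one, integral_const, probReal_univ,
      smul_eq_mul] at hville
    have hsub : μ.real {ω | ENNReal.ofReal r ≤ maximal f ω} ≤ μ.real {ω | ∃ n,
        Real.exp (-(κ * b ^ 2)) * Real.cosh (l * t) ≤ Real.exp (-(κ * D ^ 2
      * ∑ i ∈ Finset.range n, μ[fun ω ↦ ‖increment f (i + 1) ω‖ ^ 2 | ℱ i] ω))
        * Real.cosh (l * ‖f n ω‖)} := by
      refine ENNReal.toReal_mono (measure_ne_top _ _) (measure_mono_ae ?_)
      filter_upwards [hsum] with ω h hω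
      have h1 : ENNReal.ofReal t < maximal f ω :=
        ((ENNReal.ofReal_lt_ofReal_iff (ht.trans_lt htr)).2 htr).trans_le hω
      obtain ⟨n, hn⟩ := lt_iSup_iff.1 h1
      rw [← ofReal_norm] at hn
      have hn' : t ≤ ‖f n ω‖ := ((ENNReal.ofReal_lt_ofReal_iff_of_nonneg ht).1 hn).le
      refine ⟨n, mul_le_mul (Real.exp_le_exp.2 (neg_le_neg ?_)) ?_ (Real.cosh_pos _).le
        (Real.exp_pos _).le⟩
      · rw [mul_assoc]
        refine mul_le_mul_of_nonneg_left ?_ hκ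
        have h2 := mul_le_mul_of_nonneg_left (h n) (sq_nonneg D)
        rwa [← mul_pow, mul_div_cancel₀ _ hD.ne'] at h2
      · rw [Real.cosh_le_cosh, abs_of_nonneg (by positivity), abs_of_nonneg (by positivity)]
        exact mul_le_mul_of_nonneg_left hn' hl
    have hc : Real.exp (l * t - κ * b ^ 2) / 2 ≤ Real.exp (-(κ * b ^ 2)) * Real.cosh (l * t) := by
      rw [Real.cosh_eq, sub_eq_add_neg, Real.exp_add]
      nlinarith [Real.exp_pos (-(κ * b ^ 2)), Real.exp_pos (-(l * t)),
        mul_pos (Real.exp_pos (-(κ * b ^ 2))) (Real.exp_pos (-(l * t)))]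
    have hfin := (mul_le_mul hc hsub measureReal_nonneg
      (mul_nonneg (Real.exp_pos _).le (Real.cosh_pos _).le)).trans hville
    rw [← neg_sub, Real.exp_neg, ← div_eq_mul_inv, le_div_iff₀ (Real.exp_pos _)]
    linarith
  rcases le_or_gt r 0 with hr | hr
  · have h1 : (1 : ℝ) ≤ Real.exp (κ * b ^ 2 - l * r) :=
      Real.one_le_exp (by nlinarith [mul_nonneg hκ (sq_nonneg b)])
    linarith [measureReal_le_one (μ := μ) (s := {ω | ENNReal.ofReal r ≤ maximal f ω})]
  · have hcont : Continuous fun t : ℝ ↦ 2 * Real.exp (κ * b ^ 2 - l * t) := by fun_prop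
    refine ge_of_tendsto (hcont.continuousWithinAt (s := Set.Iio r) (x := r)) ?_
    filter_upwards [Ioo_mem_nhdsLT hr] with t ht
    exact hlt t ht.1.le ht.2

end Martingale

/-! ### Choice of the parameter -/

theorem exp_sub_mul_log_one_add_le_rpow {s c u : ℝ} (hs : 0 ≤ s) (hc : 0 ≤ c) (hu : 0 < u) :
    Real.exp (s - (s + c) * Real.log (1 + u)) ≤ (Real.exp 1 / u) ^ s := by
  rw [Real.rpow_def_of_pos (by positivity), Real.log_div (Real.exp_ne_zero _) hu.ne',
    Real.log_exp, Real.exp_le_exp]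
  have h1 : Real.log u ≤ Real.log (1 + u) := Real.log_le_log hu (by linarith)
  have h2 : 0 ≤ Real.log (1 + u) := Real.log_nonneg (by linarith)
  nlinarith [mul_nonneg hc h2, mul_le_mul_of_nonneg_left h1 hs]

theorem theorem3p4 {Ω E : Type*} [m : MeasurableSpace Ω] (μ : Measure Ω) [IsProbabilityMeasure μ]
    [NormedAddCommGroup E] [NormedSpace ℝ E] [CompleteSpace E] [TopologicalSpace.SeparableSpace E]
    (D : ℝ) (hE : IsTwoSmooth E D)
    (ℱ : Filtration ℕ m) (f : ℕ → Ω → E) (hf : Martingale f ℱ μ) (hf0 : f 0 = 0)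
    (a b : ℝ) (ha : 0 < a) (hb : 0 < b)
    (hd : eLpNorm (maximal (increment f)) ∞ μ ≤ ENNReal.ofReal a)
    (hs : eLpNorm (condSquare μ ℱ f) ∞ μ ≤ ENNReal.ofReal (b / D))
    (r : ℝ) (hr : 0 ≤ r) :
    μ.real {ω | ENNReal.ofReal r ≤ maximal f ω}
        ≤ 2 * Real.exp (r / a - (r / a + b ^ 2 / a ^ 2) * Real.log (1 + r * a / b ^ 2)) ∧
      2 * Real.exp (r / a - (r / a + b ^ 2 / a ^ 2) * Real.log (1 + r * a / b ^ 2))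
        ≤ 2 * (Real.exp 1 * b ^ 2 / (r * a)) ^ (r / a) := by
  have hu : 0 ≤ r * a / b ^ 2 := by positivity
  constructor
  -- The minimiser in `l` solves `(exp (l a) - 1) b² / a = r`.
  · have hl : 0 ≤ Real.log (1 + r * a / b ^ 2) / a :=
      div_nonneg (Real.log_nonneg (by linarith)) ha.le
    refine (hE.measureReal_le_maximal_le hf hf0 hl ha hb hd hs r).trans (le_of_eq ?_)
    congr 2
    rw [div_mul_cancel₀ _ ha.ne', Real.exp_log (by linarith)]
    field_simp
    ring
  · rcases hr.eq_or_lt with rfl | hr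
    -- At `r = 0` the exponent is `0`, so `rpow` returns `1` despite the division by zero in the
    -- base.
    · simp
    have h := exp_sub_mul_log_one_add_le_rpow (s := r / a) (c := b ^ 2 / a ^ 2)
      (u := r * a / b ^ 2) (by positivity) (by positivity) (by positivity)
    rw [div_div_eq_mul_div] at h
    linarith
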